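/- Let $N,M\ge 0$ be integers. For an integer $d\ge 1$, an $N\to M$ cloner in dimension $d$ is a quantum channel $T$ (a completely positive trace-preserving linear map) from the operators on $(\mathbb C^d)^{\otimes N}$ to the operators on $(\mathbb C^d)^{\otimes M}$; no symmetry between the $M$ outputs is assumed. For a unit vector $\psi\in\mathbb C^d$ and $1\le k\le M$, let $\sigma_k(\psi)$ be the reduced state of the $k$-th output, i.e. the partial trace of $T\big((|\psi\rangle\langle\psi|)^{\otimes N}\big)$ over all tensor factors except the $k$-th, and let $$F_T(\psi)=\sum_{k=1}^M\langle\psi,\sigma_k(\psi)\psi\rangle$$ be the sum of the single-particle fidelities of the $M$ outputs with the input state. Then for every $d\ge 1$ and every $N\to M$ cloner $T$ in dimension $d$: (a) there is a unit vector $\psi\in\mathbb C^d$ with $$F_T(\psi)\le\frac{N(d+M)+M-N}{d+N},$$ that is, no cloner has a sum of fidelities exceeding this bound on all pure input states; (b) the same bound holds on average over uniformly distributed input states: for every unit vector $\varphi\in\mathbb C^d$, the function $U\mapsto F_T(U\varphi)$ is integrable with respect to the normalized Haar measure $dU$ of the unitary group $U(d)$, and $$\int_{U(d)}F_T(U\varphi)\,dU\le\frac{N(d+M)+M-N}{d+N}.$$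 Moreover, for fixed $N$ and $M$, $\ \dfrac{N(d+M)+M-N}{d+N}=N+O(1/d)$ as $d\to\infty$. -/

import Mathlib

open MeasureTheory Filter Asymptotics

namespace QuantumCloning

/-- The one-particle Hilbert space `ℂ^d`. -/
abbrev Space (d : ℕ) : Type := EuclideanSpace ℂ (Fin d)

/-- The index set of the product basis of `(ℂ^d)^{⊗ n}`. -/
abbrev Config (d n : ℕ) : Type := Fin n → Fin d

/-- The operators on `(ℂ^d)^{⊗ n}`, written as matrices in the product basis. -/
abbrev Op (d n : ℕ) : Type := Matrix (Config d n) (Config d n) ℂ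

section Cloner

open scoped Matrix.Norms.L2Operator MatrixOrder

/-- An `N → M` cloner in dimension `d`: a quantum channel, i.e. a completely positive
trace-preserving linear map, from the operators on `(ℂ^d)^{⊗ N}` to those on `(ℂ^d)^{⊗ M}`.
No symmetry between the `M` outputs is required. The positive elements of the matrix algebras
are the positive semidefinite matrices. -/
structure Cloner (d N M : ℕ) extends CompletelyPositiveMap (Op d N) (Op d M) where
  trace_map' : ∀ ρ : Op d N, (toLinearMap ρ).trace = ρ.trace

/-- The underlying linear map of a cloner, sending an input state to the joint output state. -/
noncomputable def Cloner.map {d N M : ℕ} (T : Cloner d N M) : Op d N →ₗ[ℂ] Op d M :=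
  T.toLinearMap

end Cloner

/-- The operator `(|ψ⟩⟨ψ|)^{⊗ n}`. -/
def pureTensorPower {d : ℕ} (n : ℕ) (ψ : Space d) : Op d n :=
  Matrix.of fun x y => ∏ i, ψ (x i) * star (ψ (y i))

/-- The reduced operator of the `k`-th particle: the partial trace over all the other tensor
factors. The sum runs over the configurations `x` whose `k`-th entry is `a`. -/
def reduced {d n : ℕ} (σ : Op d n) (k : Fin n) : Matrix (Fin d) (Fin d) ℂ :=
  Matrix.of fun a b => ∑ x : Config d n with x k = a, σ x (Function.update x k b)

/-- The fidelity `⟨ψ, σ ψ⟩` of a one-particle state `σ` with the pure state `ψ`. -/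
noncomputable def fidelity {d : ℕ} (ψ : Space d) (σ : Matrix (Fin d) (Fin d) ℂ) : ℝ :=
  (inner ℂ ψ (Matrix.toEuclideanLin σ ψ)).re

/-- The sum over the `M` outputs of the cloner `T` of their one-particle fidelities with the
input state `ψ`, when the cloner is fed with `N` copies of `ψ`. -/
noncomputable def Cloner.totalFidelity {d N M : ℕ} (T : Cloner d N M) (ψ : Space d) : ℝ :=
  ∑ k : Fin M, fidelity ψ (reduced (T.map (pureTensorPower N ψ)) k)

/-- The unitary group `U(d)`. -/
abbrev UGroup (d : ℕ) : Type := Matrix.unitaryGroup (Fin d) ℂ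

/-- The action of a unitary matrix on a vector. -/
noncomputable def rotate {d : ℕ} (U : UGroup d) (φ : Space d) : Space d :=
  Matrix.toEuclideanLin (U : Matrix (Fin d) (Fin d) ℂ) φ

noncomputable instance (d : ℕ) : MeasurableSpace (UGroup d) := borel _

instance (d : ℕ) : BorelSpace (UGroup d) := ⟨rfl⟩

instance (d : ℕ) : CompactSpace (UGroup d) := by
  apply isCompact_iff_compactSpace.mp
  have hK : IsCompact (Set.pi Set.univ fun _ : Fin d => Set.pi Set.univ fun _ : Fin d =>
      Metric.closedBall (0 : ℂ) 1) :=
    isCompact_univ_pi fun _ => isCompact_univ_pi fun _ => isCompact_closedBall _ _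
  refine IsCompact.of_isClosed_subset hK ?_ ?_
  · have h : ((Matrix.unitaryGroup (Fin d) ℂ : Submonoid _) : Set (Matrix (Fin d) (Fin d) ℂ))
        = {A | star A * A = 1} ∩ {A | A * star A = 1} := by
      ext A
      exact Unitary.mem_iff
    rw [h]
    exact (isClosed_eq (by fun_prop) continuous_const).inter
      (isClosed_eq (by fun_prop) continuous_const)
  · intro U hU i _ j _
    simpa using entry_norm_bound_of_unitary hU i j

/-- The normalized Haar measure of `U(d)`. -/
noncomputable def haarU (d : ℕ) : Measure (UGroup d) := Measure.haarMeasure ⊤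

instance (d : ℕ) : IsProbabilityMeasure (haarU d) :=
  ⟨by simpa [haarU] using
    Measure.haarMeasure_self (K₀ := (⊤ : TopologicalSpace.PositiveCompacts (UGroup d)))⟩

/-- The bound `(N (d + M) + M - N) / (d + N)`, a real number. -/
noncomputable def cloningBound (d N M : ℕ) : ℝ :=
  ((N : ℝ) * ((d : ℝ) + M) + M - N) / ((d : ℝ) + N)

end QuantumCloning

namespace QuantumCloning

open scoped ComplexOrder

variable {d N M n : ℕ}

/-! The average over the unitary orbit is bounded; (a) follows because some state does no better
than the mean. The total fidelity is linear in the `N + 1`-fold power of the input projection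
(`totalFidelity_eq`), so its average pairs `moment (N + 1) φ` with the Choi matrix.

Unitary invariance and permutation symmetry give a recursion lowering the degree of the moments
(`moment_cons_cons`). Multiplied by `d + N`, the average becomes `M` plus the pairing of `(moment N
φ ⊗ 1) * ∑ k, ∑ i, contraction i k` with the Choi matrix.

For each input, the contractions with all outputs sum to at most `d + M - 1` (`sum_contraction_le`):
one particle cannot be maximally entangled with several. Since `moment N φ ⊗ 1` commutes with the
summed contractions, multiplying by it preserves this inequality, and so does pairing with the
positive Choi matrix. As `moment N φ ⊗ 1` pairs to `1`, the second term is at most `N * (d + M -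
1)`. -/

/-! ### Algebra of contractions and the monogamy bound. -/

/-- The operator `d Ω` contracting the `i`-th input with the `k`-th output, where `Ω` is the
projection onto the maximally entangled state. -/
def contraction (i : Fin N) (k : Fin M) :
    Matrix (Config d N × Config d M) (Config d N × Config d M) ℂ :=
  Matrix.of fun p q => if p.1 i = p.2 k then
    ∑ a, if q = (Function.update p.1 i a, Function.update p.2 k a) then 1 else 0 else 0

lemma contraction_mulVec (i : Fin N) (k : Fin M) (f : Config d N × Config d M → ℂ)
    (p : Config d N × Config d M) :
    (contraction i k).mulVec f p = if p.1 i = p.2 k then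
      ∑ a, f (Function.update p.1 i a, Function.update p.2 k a) else 0 := by
  simp only [contraction, Matrix.mulVec, dotProduct, Matrix.of_apply]
  split_ifs
  · simp only [Finset.sum_mul]
    rw [Finset.sum_comm]
    simp
  · simp

lemma contraction_apply (i : Fin N) (k : Fin M) (x y : Config d N) (u v : Config d M) :
    contraction i k (x, u) (y, v) = if x = Function.update y i (u k) ∧
      v = Function.update u k (y i) then 1 else 0 := by
  simp only [contraction, Matrix.of_apply, Prod.mk.injEq]
  by_cases h : x i = u k
  · rw [if_pos h, Finset.sum_eq_single (y i)]
    · refine if_congr (and_congr_left fun _ => ?_) rfl rfl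
      constructor
      · intro hy
        rw [hy, ← h]
        simp
      · intro hx
        rw [hx]
        simp
    · intro a _ ha
      rw [if_neg]
      rintro ⟨h1, -⟩
      apply ha
      rw [h1]
      simp
    · simp
  · rw [if_neg h, if_neg]
    rintro ⟨h1, -⟩
    apply h
    rw [h1]
    simp

lemma contraction_apply_comm (i : Fin N) (k : Fin M) (p q : Config d N × Config d M) :
    contraction i k p q = contraction i k q p := by
  obtain ⟨x, u⟩ := p
  obtain ⟨y, v⟩ := q
  rw [contraction_apply, contraction_apply]
  refine if_congr ?_ rfl rfl
  constructor <;> rintro ⟨rfl, rfl⟩ <;> simp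

lemma contraction_isHermitian (i : Fin N) (k : Fin M) :
    (contraction (d := d) i k).IsHermitian := by
  ext p q
  rw [Matrix.conjTranspose_apply, contraction_apply_comm]
  simp only [contraction, Matrix.of_apply]
  split_ifs <;> simp

lemma contraction_mul_self (i : Fin N) (k : Fin M) :
    contraction (d := d) i k * contraction i k = (d : ℂ) • contraction i k := by
  refine Matrix.ext_of_mulVec_single fun q => funext fun p => ?_
  rw [← Matrix.mulVec_mulVec, contraction_mulVec, Matrix.smul_mulVec, Pi.smul_apply,
    contraction_mulVec]
  simp only [contraction_mulVec]
  split_ifs <;> simp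

/-- Temperley–Lieb relation: the strand passing through the three contractions straightens and no
closed loop, hence no factor `d`, appears. -/
lemma contraction_mul_mul (i : Fin N) {k l : Fin M} (h : k ≠ l) :
    contraction (d := d) i k * contraction i l * contraction i k = contraction i k := by
  refine Matrix.ext_of_mulVec_single fun q => funext fun p => ?_
  rw [mul_assoc, ← Matrix.mulVec_mulVec, ← Matrix.mulVec_mulVec, contraction_mulVec,
    contraction_mulVec]
  simp only [contraction_mulVec]
  split_ifs with h1
  · rw [Finset.sum_eq_single (p.2 l)]
    · simp only [Function.update_self, Function.update_of_ne h.symm, if_true,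
        Function.update_idem]
      rw [Finset.sum_eq_single (p.2 l)]
      · have e : ∀ a, Function.update (Function.update p.2 k a) l (p.2 l)
            = Function.update p.2 k a := fun a => by
          rw [Function.update_comm h, Function.update_eq_self]
        simp [h, e]
      · intro b _ hb
        simp [h, hb]
      · simp
    · intro b _ hb
      simp [h.symm, hb]
    · simp
  · rfl

/-- By the relations above, this Hermitian operator `X` satisfies `X * X = (2 * d - 2) • X`, so for
`d > 1` it is a positive multiple of a square. -/
lemma contraction_add_posSemidef (hd1 : 1 ≤ d) (i : Fin N) {k l : Fin M} (h : k ≠ l) :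
    (contraction (d := d) i k + contraction i l - contraction i k * contraction i l
      - contraction i l * contraction i k).PosSemidef := by
  have hAA := contraction_mul_self (d := d) i k
  have hBB := contraction_mul_self (d := d) i l
  have hABA := contraction_mul_mul (d := d) i h
  have hBAB := contraction_mul_mul (d := d) i h.symm
  have hA := (contraction_isHermitian (d := d) i k).eq
  have hB := (contraction_isHermitian (d := d) i l).eq
  generalize contraction (d := d) i k = A at *
  generalize contraction (d := d) i l = B at *
  rcases hd1.lt_or_eq with hd | rfl
  · set X := A + B - A * B - B * A with hX
    have hXh : X.conjTranspose = X := by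
      rw [hX]
      simp only [Matrix.conjTranspose_sub, Matrix.conjTranspose_add, Matrix.conjTranspose_mul,
        hA, hB]
      abel
    have hABB : A * B * B = (d : ℂ) • (A * B) := by rw [mul_assoc, hBB, mul_smul_comm]
    have hBAA : B * A * A = (d : ℂ) • (B * A) := by rw [mul_assoc, hAA, mul_smul_comm]
    have hsq : X * X = (2 * d - 2 : ℂ) • X := by
      rw [hX]
      simp only [mul_sub, sub_mul, mul_add, add_mul, ← mul_assoc, hAA, hBB, hABA, hBAB, hABB, hBAA,
        smul_mul_assoc]
      module
    have hc : (2 * d - 2 : ℂ)⁻¹ = (((2 * d - 2 : ℝ)⁻¹ : ℝ) : ℂ) := by push_cast; rfl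
    have hpos : (0 : ℝ) < 2 * d - 2 := by
      have : (1 : ℝ) < d := by exact_mod_cast hd
      linarith
    have hc0 : (2 * d - 2 : ℂ) ≠ 0 := by
      have := hpos.ne'
      exact_mod_cast this
    have hXX : X = (2 * d - 2 : ℂ)⁻¹ • (X.conjTranspose * X) := by
      rw [hXh, hsq, smul_smul, inv_mul_cancel₀ hc0, one_smul]
    rw [hXX]
    refine (Matrix.posSemidef_conjTranspose_mul_self X).smul ?_
    rw [hc]
    exact_mod_cast (inv_pos.mpr hpos).le
  -- For `d = 1` the factor `2 * d - 2` vanishes, but the contractions are projections.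
  · have : A + B - A * B - B * A = (A - B).conjTranspose * (A - B) := by
      rw [Matrix.conjTranspose_sub, hA, hB]
      simp only [mul_sub, sub_mul, hAA, hBB]
      simp only [Nat.cast_one, one_smul]
      abel
    rw [this]
    exact Matrix.posSemidef_conjTranspose_mul_self _

/-- The contractions of one input with all outputs add up to an operator that is at most
`d + M - 1`. -/
lemma sum_contraction_le (hd : 1 ≤ d) (i : Fin N) :
    (((d : ℝ) + M - 1 : ℝ) • (1 : Matrix (Config d N × Config d M) (Config d N × Config d M) ℂ)
      - ∑ k, contraction i k).PosSemidef := by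
  have h1 : (1 : ℝ) ≤ d := by exact_mod_cast hd
  rcases Nat.eq_zero_or_pos M with rfl | hM
  -- Without outputs the constant is `d - 1`, possibly zero, and cannot be inverted as below.
  · simpa using Matrix.PosSemidef.one.smul (sub_nonneg.mpr h1)
  set S : Matrix (Config d N × Config d M) (Config d N × Config d M) ℂ :=
    ∑ k, contraction i k with hS
  set c : ℝ := (d : ℝ) + M - 1 with hc
  have hcpos : 0 < c := by
    have h2 : (1 : ℝ) ≤ M := by exact_mod_cast hM
    linarith
  have hSh : S.conjTranspose = S := by
    rw [hS, Matrix.conjTranspose_sum]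
    exact Finset.sum_congr rfl fun k _ => (contraction_isHermitian i k).eq
  -- Half the sum of the pair inequalities over `k ≠ l` is `(M - 1) • S - (S * S - d • S)`, which is
  -- where `c` comes from.
  have hdiff : (c • S - S * S).PosSemidef := by
    have hdiag : ∀ k : Fin M, contraction (d := d) i k + contraction i k
        - contraction i k * contraction i k - contraction i k * contraction i k
        = ((2 - 2 * d : ℝ)) • contraction i k := fun k => by
      rw [contraction_mul_self, Nat.cast_smul_eq_nsmul, ← Nat.cast_smul_eq_nsmul ℝ]
      module
    have e : c • S - S * S = (2⁻¹ : ℝ) • ∑ k, ∑ l ∈ Finset.univ.erase k,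
        (contraction (d := d) i k + contraction i l - contraction i k * contraction i l
          - contraction i l * contraction i k) := by
      simp only [Finset.sum_erase_eq_sub (Finset.mem_univ _), hdiag, Finset.sum_sub_distrib,
        Finset.sum_add_distrib, ← Finset.mul_sum, ← Finset.sum_mul, Finset.sum_const,
        Finset.card_univ, Fintype.card_fin, ← Finset.smul_sum, ← hS,
        ← Nat.cast_smul_eq_nsmul ℝ]
      rw [hc]
      module
    rw [e]
    refine Matrix.PosSemidef.smul ?_ (by norm_num)
    exact Matrix.posSemidef_sum _ fun k _ => Matrix.posSemidef_sum _ fun l hl =>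
      contraction_add_posSemidef hd i (Finset.ne_of_mem_erase hl).symm
  -- `S * S ≤ c • S` forces `S ≤ c`, since `(c - S)² + (c S - S²) = c (c - S)`.
  have e : c • (1 : Matrix (Config d N × Config d M) (Config d N × Config d M) ℂ) - S =
      c⁻¹ • ((c • 1 - S).conjTranspose * (c • 1 - S) + (c • S - S * S)) := by
    rw [Matrix.conjTranspose_sub, Matrix.conjTranspose_smul, hSh]
    simp only [Matrix.conjTranspose_one, star_trivial, mul_sub, sub_mul, smul_mul_assoc,
      mul_smul_comm, one_mul, mul_one]
    have : c⁻¹ * c = 1 := inv_mul_cancel₀ hcpos.ne'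
    simp only [smul_add, smul_sub, smul_smul, ← mul_assoc, this]
    module
  rw [e]
  refine Matrix.PosSemidef.smul ?_ (inv_nonneg.mpr hcpos.le)
  exact (Matrix.posSemidef_conjTranspose_mul_self _).add hdiff

/-! ### Choi matrix of a cloner. -/

/-- The Choi matrix of a cloner. -/
noncomputable def Cloner.choi (T : Cloner d N M) :
    Matrix (Config d N × Config d M) (Config d N × Config d M) ℂ :=
  Matrix.of fun p q => T.map (Matrix.single p.1 q.1 1) p.2 q.2

lemma exists_eq_star_mul_self_of_nonneg {A : Type*} [NonUnitalCStarAlgebra A] [PartialOrder A]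
    [StarOrderedRing A] {a : A} (ha : 0 ≤ a) : ∃ b, a = star b * b :=
  CStarAlgebra.nonneg_iff_eq_star_mul_self.mp ha

section

open scoped Matrix.Norms.L2Operator MatrixOrder

/-- The block matrix of all matrix units is positive; complete positivity keeps it positive after
applying `T` to each block, and a square root gives `B`. -/
lemma Cloner.exists_map_single (T : Cloner d N M) :
    ∃ B : Config d N → Config d N → Op d M, ∀ x y,
      T.map (Matrix.single x y 1) = ∑ r, (B r x).conjTranspose * B r y := by
  rcases isEmpty_or_nonempty (Config d N) with h | ⟨⟨o⟩⟩
  · exact ⟨fun x => isEmptyElim x, fun x => isEmptyElim x⟩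
  -- A single nonzero row, with blocks `|o⟩⟨x|`, suffices: `(|o⟩⟨x|)* |o⟩⟨y| = |x⟩⟨y|`.
  let A : CStarMatrix (Config d N) (Config d N) (Op d N) :=
    CStarMatrix.ofMatrix (Matrix.of fun r x => if r = o then Matrix.single o x 1 else 0)
  have hA : ∀ x y, (star A * A) x y = Matrix.single x y (1 : ℂ) := by
    intro x y
    rw [CStarMatrix.mul_apply, Finset.sum_eq_single o]
    · rw [CStarMatrix.star_apply]
      change star (if o = o then Matrix.single o x (1 : ℂ) else 0) *
        (if o = o then Matrix.single o y (1 : ℂ) else 0) = _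
      simp [Matrix.star_eq_conjTranspose]
    · intro r _ hr
      change _ * (if r = o then Matrix.single o y (1 : ℂ) else 0) = _
      simp [hr]
    · simp
  have hpos := T.toCompletelyPositiveMap.map_cstarMatrix_nonneg (star A * A)
    (star_mul_self_nonneg A)
  obtain ⟨B, hB⟩ := exists_eq_star_mul_self_of_nonneg hpos
  refine ⟨fun r x => B r x, fun x y => ?_⟩
  have h := congrFun (congrFun hB x) y
  rw [CStarMatrix.map_apply, hA, CStarMatrix.mul_apply] at h
  exact h

end

lemma Cloner.choi_posSemidef (T : Cloner d N M) : T.choi.PosSemidef := by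
  obtain ⟨B, hB⟩ := T.exists_map_single
  let K : Matrix (Config d N × Config d M) (Config d N × Config d M) ℂ :=
    Matrix.of fun p q => B p.1 q.1 p.2 q.2
  have h : T.choi = K.conjTranspose * K := by
    ext p q
    simp [Cloner.choi, hB, Matrix.mul_apply, Matrix.sum_apply, Fintype.sum_prod_type, K]
  rw [h]
  exact Matrix.posSemidef_conjTranspose_mul_self K

lemma Cloner.map_apply (T : Cloner d N M) (ρ : Op d N) (u v : Config d M) :
    T.map ρ u v = ∑ x, ∑ y, ρ x y * T.choi (x, u) (y, v) := by
  conv_lhs => rw [Matrix.matrix_eq_sum_single ρ]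
  simp only [map_sum, Matrix.sum_apply]
  refine Finset.sum_congr rfl fun x _ => Finset.sum_congr rfl fun y _ => ?_
  have : Matrix.single x y (ρ x y) = ρ x y • Matrix.single x y 1 := by simp
  rw [this, map_smul]
  rfl

lemma Cloner.sum_choi (T : Cloner d N M) (x y : Config d N) :
    ∑ u, T.choi (x, u) (y, u) = if x = y then 1 else 0 := by
  have h := T.trace_map' (Matrix.single x y 1)
  have h2 : ∑ u, T.choi (x, u) (y, u) = (Matrix.single x y (1 : ℂ)).trace := h
  rw [h2]
  split_ifs with hxy
  · subst hxy; simp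
  · simp [Matrix.trace_single_eq_of_ne _ _ _ hxy]

/-! ### Unitary orbits and Haar averages. -/

lemma continuous_rotate_apply (φ : Space d) (a : Fin d) :
    Continuous fun U : UGroup d => rotate U φ a := by
  have h : ∀ U : UGroup d, rotate U φ a = ∑ b, (U : Matrix (Fin d) (Fin d) ℂ) a b * φ b :=
    fun U => by simp [rotate, Matrix.toEuclideanLin, Matrix.mulVec, dotProduct]
  simp only [h]
  refine continuous_finsetSum _ fun b _ => ?_
  exact (continuous_subtype_val.matrix_elem a b).mul continuous_const

lemma integrable_of_continuous {E : Type*} [NormedAddCommGroup E] {f : UGroup d → E}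
    (hf : Continuous f) : Integrable f (haarU d) :=
  hf.integrable_of_hasCompactSupport (HasCompactSupport.of_compactSpace f)

lemma rotate_mul (V U : UGroup d) (φ : Space d) : rotate (V * U) φ = rotate V (rotate U φ) := by
  ext a
  simp [rotate, Matrix.toEuclideanLin, Matrix.mulVec_mulVec]

lemma norm_rotate (U : UGroup d) (φ : Space d) : ‖rotate U φ‖ = ‖φ‖ := by
  have h : inner ℂ (rotate U φ) (rotate U φ) = inner ℂ φ φ := by
    have hU : (U : Matrix (Fin d) (Fin d) ℂ).conjTranspose * U = 1 := Unitary.coe_star_mul_self U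
    simp only [rotate, EuclideanSpace.inner_eq_star_dotProduct, Matrix.ofLp_toLpLin,
      Matrix.toLin'_apply]
    rw [Matrix.star_mulVec, dotProduct_comm, ← Matrix.dotProduct_mulVec, Matrix.mulVec_mulVec, hU,
      Matrix.one_mulVec, dotProduct_comm]
  rw [@norm_eq_sqrt_re_inner ℂ, h, ← @norm_eq_sqrt_re_inner ℂ]

lemma sum_mul_star_eq_one {ψ : Space d} (hψ : ‖ψ‖ = 1) : ∑ a, ψ a * star (ψ a) = 1 := by
  have h : inner ℂ ψ ψ = ∑ a, ψ a * star (ψ a) := by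
    simp only [PiLp.inner_apply, RCLike.inner_apply]
    rfl
  rw [← h, inner_self_eq_norm_sq_to_K, hψ]
  simp

instance : (haarU d).IsMulLeftInvariant := by unfold haarU; infer_instance

lemma integral_rotate_rotate {E : Type*} [NormedAddCommGroup E] [NormedSpace ℝ E] (V : UGroup d)
    (φ : Space d) (f : Space d → E) :
    ∫ U, f (rotate V (rotate U φ)) ∂haarU d = ∫ U, f (rotate U φ) ∂haarU d := by
  simp only [← rotate_mul]
  exact integral_mul_left_eq_self (fun U => f (rotate U φ)) V

/-! ### Tensor powers and moments of the orbit. -/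

/-- The `n`-th tensor power of a one-particle operator. -/
def tensorPower (n : ℕ) (V : Matrix (Fin d) (Fin d) ℂ) : Op d n :=
  Matrix.of fun x y => ∏ i, V (x i) (y i)

lemma tensorPower_mulVec (V : Matrix (Fin d) (Fin d) ℂ) (v : Fin d → ℂ) :
    (tensorPower n V).mulVec (fun x => ∏ i, v (x i)) = fun x => ∏ i, V.mulVec v (x i) := by
  ext x
  simp only [tensorPower, Matrix.mulVec, dotProduct, Matrix.of_apply, Finset.prod_univ_sum,
    Fintype.piFinset_univ, ← Finset.prod_mul_distrib]

lemma tensorPower_mul (V W : Matrix (Fin d) (Fin d) ℂ) :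
    tensorPower n V * tensorPower n W = tensorPower n (V * W) := by
  ext x y
  simp only [tensorPower, Matrix.mul_apply, Matrix.of_apply, Finset.prod_univ_sum,
    Fintype.piFinset_univ, ← Finset.prod_mul_distrib]

lemma tensorPower_one : tensorPower n (1 : Matrix (Fin d) (Fin d) ℂ) = 1 := by
  ext x y
  simp only [tensorPower, Matrix.of_apply, Matrix.one_apply, funext_iff]
  rw [Finset.prod_ite_zero]
  simp

lemma tensorPower_conjTranspose (V : Matrix (Fin d) (Fin d) ℂ) :
    (tensorPower n V).conjTranspose = tensorPower n V.conjTranspose := by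
  ext x y
  simp [tensorPower]

lemma pureTensorPower_eq (ψ : Space d) : pureTensorPower n ψ =
    Matrix.vecMulVec (fun x => ∏ i, ψ (x i)) (star fun x => ∏ i, ψ (x i)) := by
  ext x y
  simp [pureTensorPower, Matrix.vecMulVec_apply, Finset.prod_mul_distrib]

lemma pureTensorPower_rotate (V : UGroup d) (ψ : Space d) : pureTensorPower n (rotate V ψ) =
    tensorPower n V.1 * pureTensorPower n ψ * (tensorPower n V.1).conjTranspose := by
  have h : (fun x : Config d n => ∏ i, rotate V ψ (x i)) =
      (tensorPower n V.1).mulVec fun x => ∏ i, ψ (x i) := by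
    rw [tensorPower_mulVec]
    rfl
  rw [pureTensorPower_eq, pureTensorPower_eq, h, Matrix.mul_vecMulVec, Matrix.vecMulVec_mul,
    Matrix.star_mulVec]

/-- The average of `(|ψ⟩⟨ψ|)^{⊗ n}` over the orbit of `φ`. -/
noncomputable def moment (n : ℕ) (φ : Space d) : Op d n :=
  Matrix.of fun x y => ∫ U, pureTensorPower n (rotate U φ) x y ∂haarU d

lemma continuous_pureTensorPower (φ : Space d) (x y : Config d n) :
    Continuous fun U : UGroup d => pureTensorPower n (rotate U φ) x y := by
  simp only [pureTensorPower, Matrix.of_apply]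
  exact continuous_finsetProd _ fun i _ =>
    (continuous_rotate_apply φ _).mul (continuous_rotate_apply φ _).star

lemma integrable_pureTensorPower (φ : Space d) (x y : Config d n) :
    Integrable (fun U : UGroup d => pureTensorPower n (rotate U φ) x y) (haarU d) :=
  integrable_of_continuous (continuous_pureTensorPower φ x y)

lemma integral_mul_pureTensorPower_mul (A B : Op d n) (φ : Space d) (x y : Config d n) :
    ∫ U, (A * pureTensorPower n (rotate U φ) * B) x y ∂haarU d = (A * moment n φ * B) x y := by
  have h1 : ∀ w z, Integrable (fun U => A x w * pureTensorPower n (rotate U φ) w z) (haarU d) :=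
    fun w z => (integrable_pureTensorPower φ w z).const_mul _
  have h2 : ∀ z, Integrable (fun U => (∑ w, A x w * pureTensorPower n (rotate U φ) w z) * B z y)
      (haarU d) := fun z => (integrable_finsetSum _ fun w _ => h1 w z).mul_const _
  simp only [Matrix.mul_apply]
  rw [integral_finsetSum _ fun z _ => h2 z]
  refine Finset.sum_congr rfl fun z _ => ?_
  rw [integral_mul_const, integral_finsetSum _ fun w _ => h1 w z]
  simp only [integral_const_mul]
  rfl

lemma tensorPower_mul_moment (V : UGroup d) (φ : Space d) :
    tensorPower n V.1 * moment n φ = moment n φ * tensorPower n V.1 := by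
  have h : tensorPower n V.1 * moment n φ * (tensorPower n V.1).conjTranspose = moment n φ := by
    ext x y
    rw [← integral_mul_pureTensorPower_mul]
    simp only [← pureTensorPower_rotate]
    exact integral_rotate_rotate V φ fun ψ => pureTensorPower n ψ x y
  have hV : (tensorPower n V.1).conjTranspose * tensorPower n V.1 = 1 := by
    rw [tensorPower_conjTranspose, tensorPower_mul, ← tensorPower_one]
    congr 1
    exact Unitary.coe_star_mul_self V
  conv_rhs => rw [← h]
  rw [mul_assoc, hV, mul_one]

/-! ### Infinitesimal invariance of the moments. -/

/-- The derivation on `(ℂ^d)^{⊗ n}` induced by a one-particle operator. -/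
def secondQuantization (n : ℕ) (X : Matrix (Fin d) (Fin d) ℂ) : Op d n :=
  Matrix.of fun x y => ∑ i, (∏ j ∈ Finset.univ.erase i, (1 : Matrix (Fin d) (Fin d) ℂ) (x j) (y j))
    * X (x i) (y i)

-- Differentiate at `t = 0` the commutation of the moment with the tensor power of the unitary `exp
-- (t • X)`.
open scoped Matrix.Norms.L2Operator in
lemma secondQuantization_mul_moment_of_skew {X : Matrix (Fin d) (Fin d) ℂ}
    (hX : X ∈ skewAdjoint (Matrix (Fin d) (Fin d) ℂ)) (φ : Space d) :
    secondQuantization n X * moment n φ = moment n φ * secondQuantization n X := by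
  let +nondep : NormedAlgebra ℚ (Matrix (Fin d) (Fin d) ℂ) := .restrictScalars ℚ ℂ _
  have hV : ∀ t : ℝ, NormedSpace.exp (t • X) ∈ Matrix.unitaryGroup (Fin d) ℂ := fun t =>
    NormedSpace.exp_mem_unitary_of_mem_skewAdjoint (skewAdjoint.smul_mem t hX)
  have hexp : HasDerivAt (fun t : ℝ => NormedSpace.exp (t • X)) X 0 := by
    simpa using hasDerivAt_exp_smul_const X (0 : ℝ)
  have hentry : ∀ a b, HasDerivAt (fun t : ℝ => NormedSpace.exp (t • X) a b) (X a b) 0 := by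
    intro a b
    exact ((Matrix.entryLinearMap ℝ ℂ a b).toContinuousLinearMap.hasFDerivAt.comp_hasDerivAt 0 hexp)
  have hpow : ∀ x y : Config d n, HasDerivAt
      (fun t : ℝ => tensorPower n (NormedSpace.exp (t • X)) x y)
      (secondQuantization n X x y) 0 := by
    intro x y
    have := HasDerivAt.fun_finsetProd (u := Finset.univ) fun i (_ : i ∈ Finset.univ) =>
      hentry (x i) (y i)
    simpa [tensorPower, secondQuantization] using this
  ext x y
  simp only [Matrix.mul_apply]
  refine HasDerivAt.unique (f := fun t : ℝ => ∑ z, tensorPower n (NormedSpace.exp (t • X)) x z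
    * moment n φ z y) (x := 0) ?_ ?_
  · exact HasDerivAt.fun_sum fun z _ => (hpow x z).mul_const _
  · have : (fun t : ℝ => ∑ z, tensorPower n (NormedSpace.exp (t • X)) x z * moment n φ z y) =
        fun t : ℝ => ∑ z, moment n φ x z * tensorPower n (NormedSpace.exp (t • X)) z y := by
      funext t
      simpa only [Matrix.mul_apply] using
        congrFun (congrFun (tensorPower_mul_moment (n := n) ⟨_, hV t⟩ φ) x) y
    rw [this]
    exact HasDerivAt.fun_sum fun z _ => (hpow z y).const_mul _

lemma secondQuantization_add (X Y : Matrix (Fin d) (Fin d) ℂ) : secondQuantization n (X + Y) =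
    secondQuantization n X + secondQuantization n Y := by
  ext x y
  simp [secondQuantization, mul_add, Finset.sum_add_distrib]

lemma secondQuantization_smul (c : ℂ) (X : Matrix (Fin d) (Fin d) ℂ) :
    secondQuantization n (c • X) = c • secondQuantization n X := by
  ext x y
  simp only [secondQuantization, Matrix.of_apply, Matrix.smul_apply, smul_eq_mul, Finset.mul_sum]
  exact Finset.sum_congr rfl fun i _ => by ring

/-- Every matrix is a complex combination of two skew-adjoint ones, and the condition is complex
linear in `X`. Matrix units thereby become admissible. -/
lemma secondQuantization_mul_moment (X : Matrix (Fin d) (Fin d) ℂ) (φ : Space d) :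
    secondQuantization n X * moment n φ = moment n φ * secondQuantization n X := by
  have hdec : X = (2⁻¹ : ℂ) • (X - X.conjTranspose) +
      (-Complex.I / 2) • (Complex.I • (X + X.conjTranspose)) := by
    ext a b
    simp only [Matrix.add_apply, Matrix.smul_apply, Matrix.sub_apply, smul_eq_mul]
    linear_combination ((X a b + X.conjTranspose a b) / 2) * Complex.I_mul_I
  have h1 : X - X.conjTranspose ∈ skewAdjoint (Matrix (Fin d) (Fin d) ℂ) := by
    rw [skewAdjoint.mem_iff]
    simp [Matrix.star_eq_conjTranspose]
  have h2 : Complex.I • (X + X.conjTranspose) ∈ skewAdjoint (Matrix (Fin d) (Fin d) ℂ) := by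
    rw [skewAdjoint.mem_iff]
    simp [Matrix.star_eq_conjTranspose, add_comm]
  rw [hdec, secondQuantization_add, secondQuantization_smul, secondQuantization_smul, add_mul,
    mul_add, smul_mul_assoc, smul_mul_assoc, mul_smul_comm, mul_smul_comm,
    secondQuantization_mul_moment_of_skew h1, secondQuantization_mul_moment_of_skew h2]

lemma sum_mul_secondQuantization_single (f : Config d n → ℂ) (a b : Fin d) (y : Config d n) :
    ∑ z, f z * secondQuantization n (Matrix.single a b 1) z y =
      ∑ i, if y i = b then f (Function.update y i a) else 0 := by
  simp only [secondQuantization, Matrix.of_apply, Finset.mul_sum]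
  rw [Finset.sum_comm]
  refine Finset.sum_congr rfl fun i _ => ?_
  rw [Finset.sum_eq_single (Function.update y i a)]
  · have h1 : ∏ j ∈ Finset.univ.erase i,
        (1 : Matrix (Fin d) (Fin d) ℂ) (Function.update y i a j) (y j) = 1 :=
      Finset.prod_eq_one fun j hj => by
        rw [Function.update_of_ne (Finset.ne_of_mem_erase hj), Matrix.one_apply_eq]
    rw [h1, Function.update_self, Matrix.single_apply]
    by_cases h : y i = b
    · simp [h]
    · simp [h, Ne.symm h]
  · intro z _ hz
    by_cases h : ∀ j, j ≠ i → z j = y j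
    · have : z i ≠ a := by
        rintro rfl
        refine hz (funext fun j => ?_)
        by_cases hj : j = i
        · subst hj; simp
        · simp [hj, h j hj]
      simp [this.symm]
    · push Not at h
      obtain ⟨j, hj, hne⟩ := h
      have h0 : ∏ j ∈ Finset.univ.erase i, (1 : Matrix (Fin d) (Fin d) ℂ) (z j) (y j) = 0 :=
        Finset.prod_eq_zero (Finset.mem_erase.mpr ⟨hj, Finset.mem_univ j⟩) (Matrix.one_apply_ne hne)
      rw [h0]
      simp
  · simp

lemma sum_secondQuantization_single_mul (f : Config d n → ℂ) (a b : Fin d) (x : Config d n) :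
    ∑ z, secondQuantization n (Matrix.single a b 1) x z * f z =
      ∑ i, if x i = a then f (Function.update x i b) else 0 := by
  have h : ∀ z, secondQuantization n (Matrix.single a b 1) x z =
      secondQuantization n (Matrix.single b a 1) z x := by
    intro z
    simp [secondQuantization, Matrix.one_apply, Matrix.single_apply, eq_comm, and_comm]
  simp only [h, mul_comm _ (f _)]
  exact sum_mul_secondQuantization_single f b a x

/-- The average of `(|ψ⟩⟨ψ|)^{⊗ n}` commutes with the action of the Lie algebra `gl(d)`. -/
lemma sum_moment_update (φ : Space d) (a b : Fin d) (x y : Config d n) :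
    (∑ i, if y i = b then moment n φ x (Function.update y i a) else 0) =
      ∑ i, if x i = a then moment n φ (Function.update x i b) y else 0 := by
  rw [← sum_mul_secondQuantization_single, ← sum_secondQuantization_single_mul (moment n φ · y)]
  exact (congrFun (congrFun (secondQuantization_mul_moment (Matrix.single a b 1) φ) x) y).symm

/-! ### Permutation symmetry and the recursion for moments. -/

lemma moment_comp_left (φ : Space d) (x y : Config d n) (σ : Equiv.Perm (Fin n)) :
    moment n φ (x ∘ σ) y = moment n φ x y := by
  simp only [moment, pureTensorPower, Matrix.of_apply, Finset.prod_mul_distrib,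
    Function.comp_apply]
  refine integral_congr_ae (ae_of_all _ fun U => ?_)
  simp only
  rw [Equiv.prod_comp σ fun i => rotate U φ (x i)]

lemma moment_comp_right (φ : Space d) (x y : Config d n) (σ : Equiv.Perm (Fin n)) :
    moment n φ x (y ∘ σ) = moment n φ x y := by
  simp only [moment, pureTensorPower, Matrix.of_apply, Finset.prod_mul_distrib,
    Function.comp_apply]
  refine integral_congr_ae (ae_of_all _ fun U => ?_)
  simp only
  rw [Equiv.prod_comp σ fun i => star (rotate U φ (y i))]

/-- With permutation symmetry, this lets a moment exchange its head index with the one at position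
`i`. -/
lemma cons_update_comp_swap (x : Config d n) (i : Fin n) (a b : Fin d) :
    (Fin.cons a (Function.update x i b) : Config d (n + 1)) =
      (Fin.cons b (Function.update x i a) : Config d (n + 1)) ∘ Equiv.swap 0 i.succ := by
  funext j
  refine Fin.cases ?_ (fun j => ?_) j
  · simp
  · by_cases hj : j = i
    · subst hj; simp [-Fin.cons_update]
    · have h : Equiv.swap 0 i.succ j.succ = j.succ :=
        Equiv.swap_apply_of_ne_of_ne (Fin.succ_ne_zero j) (by simpa using hj)
      simp [h, hj]

lemma sum_moment_cons {φ : Space d} (hφ : ‖φ‖ = 1) (x y : Config d n) :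
    ∑ c, moment (n + 1) φ (Fin.cons c x) (Fin.cons c y) = moment n φ x y := by
  simp only [moment, Matrix.of_apply]
  rw [← integral_finsetSum _ fun c _ => integrable_pureTensorPower φ _ _]
  refine integral_congr_ae (ae_of_all _ fun U => ?_)
  simp only [pureTensorPower, Matrix.of_apply, Fin.prod_univ_succ, Fin.cons_zero, Fin.cons_succ]
  rw [← Finset.sum_mul, sum_mul_star_eq_one (by rw [norm_rotate, hφ]), one_mul]

/-- Reduction of the averages of degree `n + 1` to those of degree `n`. -/
lemma moment_cons_cons {φ : Space d} (hφ : ‖φ‖ = 1) (x y : Config d n) (a b : Fin d) :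
    ((d : ℂ) + n) * moment (n + 1) φ (Fin.cons b x) (Fin.cons a y) =
      (if a = b then moment n φ x y else 0) +
        ∑ i, if y i = b then moment n φ x (Function.update y i a) else 0 := by
  have h : ∀ c, (if a = b then moment (n + 1) φ (Fin.cons c x) (Fin.cons c y) else 0) +
      (∑ i, if y i = b then moment (n + 1) φ (Fin.cons c x)
        (Fin.cons c (Function.update y i a)) else 0) =
      moment (n + 1) φ (Fin.cons b x) (Fin.cons a y) +
      ∑ i, if x i = c then moment (n + 1) φ (Fin.cons b x) (Fin.cons a y) else 0 := by
    intro c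
    -- The row's head is the index `c` to be replaced, so the head term on the right is always the
    -- desired moment. Swaps then put `c` at the head of both indices on the left.
    have h := sum_moment_update φ c b (Fin.cons c x : Config d (n + 1)) (Fin.cons a y)
    simp only [Fin.sum_univ_succ, Fin.cons_zero, Fin.cons_succ, Fin.update_cons_zero,
      ← Fin.cons_update, if_true] at h
    refine Eq.trans ?_ (h.trans ?_)
    · congr 1
      refine Finset.sum_congr rfl fun i _ => ?_
      rw [cons_update_comp_swap y i a c, moment_comp_right]
    · congr 1
      refine Finset.sum_congr rfl fun i _ => ?_
      split_ifs with hi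
      · rw [cons_update_comp_swap x i c b, moment_comp_left, ← hi, Function.update_eq_self]
      · rfl
  -- Summing over `c` makes the left side a partial trace, of degree `n`; on the right the same
  -- moment occurs `d` times from the head and once for each of the `n` positions.
  have h2 := Finset.sum_congr (rfl : (Finset.univ : Finset (Fin d)) = Finset.univ) fun c _ => h c
  rw [Finset.sum_add_distrib, Finset.sum_add_distrib, Finset.sum_comm,
    Finset.sum_comm (f := fun c i => if x i = c then _ else (0 : ℂ))] at h2
  have h3 : (∑ c, if a = b then moment (n + 1) φ (Fin.cons c x) (Fin.cons c y) else 0) =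
      if a = b then moment n φ x y else 0 := by
    split_ifs
    · exact sum_moment_cons hφ x y
    · simp
  have h4 : ∀ i, (∑ c, if y i = b then moment (n + 1) φ (Fin.cons c x)
      (Fin.cons c (Function.update y i a)) else 0) =
      if y i = b then moment n φ x (Function.update y i a) else 0 := by
    intro i
    split_ifs
    · exact sum_moment_cons hφ x _
    · simp
  rw [h3] at h2
  simp only [h4] at h2
  rw [h2]
  simp only [Finset.sum_const, Finset.card_univ, Fintype.card_fin, Finset.sum_ite_eq,
    Finset.mem_univ, if_true, nsmul_eq_mul]
  ring

lemma trace_moment {φ : Space d} (hφ : ‖φ‖ = 1) : (moment n φ).trace = 1 := by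
  simp only [Matrix.trace, Matrix.diag, moment, Matrix.of_apply]
  rw [← integral_finsetSum _ fun c _ => integrable_pureTensorPower φ _ _]
  have h : ∀ U : UGroup d, ∑ x, pureTensorPower n (rotate U φ) x x = 1 := by
    intro U
    simp only [pureTensorPower, Matrix.of_apply]
    rw [← Fintype.piFinset_univ, ← Finset.prod_univ_sum (fun _ : Fin n => Finset.univ)
      fun _ a => rotate U φ a * star (rotate U φ a)]
    rw [sum_mul_star_eq_one (by rw [norm_rotate, hφ])]
    simp
  simp [h]

lemma moment_posSemidef (φ : Space d) : (moment n φ).PosSemidef := by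
  have hpos : ∀ ψ : Space d, (pureTensorPower n ψ).PosSemidef := fun ψ => by
    rw [pureTensorPower_eq]
    exact Matrix.posSemidef_vecMulVec_self_star _
  refine Matrix.PosSemidef.of_dotProduct_mulVec_nonneg ?_ fun f => ?_
  · ext x y
    rw [Matrix.conjTranspose_apply]
    simp only [moment, Matrix.of_apply]
    change starRingEnd ℂ _ = _
    rw [← integral_conj]
    refine integral_congr_ae (ae_of_all _ fun U => ?_)
    exact congrFun (congrFun (hpos (rotate U φ)).isHermitian x) y
  · have h : star f ⬝ᵥ (moment n φ).mulVec f =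
        ∫ U, star f ⬝ᵥ (pureTensorPower n (rotate U φ)).mulVec f ∂haarU d := by
      have h1 : ∀ x y, Integrable (fun U => pureTensorPower n (rotate U φ) x y * f y) (haarU d) :=
        fun x y => (integrable_pureTensorPower φ x y).mul_const _
      have h2 : ∀ x, Integrable (fun U => star f x * ∑ y, pureTensorPower n (rotate U φ) x y * f y)
          (haarU d) := fun x => (integrable_finsetSum _ fun y _ => h1 x y).const_mul _
      simp only [dotProduct, Matrix.mulVec]
      rw [integral_finsetSum _ fun x _ => h2 x]
      refine Finset.sum_congr rfl fun x _ => ?_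
      rw [integral_const_mul, integral_finsetSum _ fun y _ => h1 x y]
      simp only [integral_mul_const]
      rfl
    rw [h]
    exact integral_nonneg fun U => (hpos (rotate U φ)).dotProduct_mulVec_nonneg f

/-- Schur product theorem, tested on the all-ones vector. -/
lemma sum_mul_nonneg_of_posSemidef {ι : Type*} [Fintype ι] {A B : Matrix ι ι ℂ}
    (hA : A.PosSemidef) (hB : B.PosSemidef) : 0 ≤ ∑ p, ∑ q, A p q * B p q := by
  have h := (hA.hadamard hB).dotProduct_mulVec_nonneg 1
  simpa [dotProduct, Matrix.mulVec] using h

/-! ### Commutation with contractions and the resulting bound. -/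

/-- The operator `moment N φ ⊗ 1` on the inputs and outputs of a cloner. -/
noncomputable def extendedMoment (N M : ℕ) (φ : Space d) :
    Matrix (Config d N × Config d M) (Config d N × Config d M) ℂ :=
  Matrix.kroneckerMap (· * ·) (moment N φ) (1 : Op d M)

lemma extendedMoment_apply (φ : Space d) (x y : Config d N) (u v : Config d M) :
    extendedMoment N M φ (x, u) (y, v) = if u = v then moment N φ x y else 0 := by
  simp [extendedMoment, Matrix.one_apply]

lemma extendedMoment_mul_contraction (φ : Space d) (i : Fin N) (k : Fin M)
    (x y : Config d N) (u v : Config d M) :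
    (extendedMoment N M φ * contraction (d := d) i k) (x, u) (y, v) =
      if v = Function.update u k (y i) then moment N φ x (Function.update y i (u k)) else 0 := by
  rw [Matrix.mul_apply, Fintype.sum_prod_type,
    Finset.sum_eq_single (Function.update y i (u k))]
  · rw [Finset.sum_eq_single u]
    · simp [extendedMoment_apply, contraction_apply]
    · intro w _ hw
      simp [extendedMoment_apply, hw.symm]
    · simp
  · intro z _ hz
    refine Finset.sum_eq_zero fun w _ => ?_
    by_cases hw : u = w
    · subst hw; simp [extendedMoment_apply, contraction_apply, hz]
    · simp [extendedMoment_apply, hw]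
  · simp

lemma contraction_mul_extendedMoment (φ : Space d) (i : Fin N) (k : Fin M)
    (x y : Config d N) (u v : Config d M) :
    (contraction (d := d) i k * extendedMoment N M φ) (x, u) (y, v) =
      if u = Function.update v k (x i) then moment N φ (Function.update x i (v k)) y else 0 := by
  rw [Matrix.mul_apply, Fintype.sum_prod_type,
    Finset.sum_eq_single (Function.update x i (v k))]
  · rw [Finset.sum_eq_single v]
    · rw [contraction_apply_comm]
      simp [extendedMoment_apply, contraction_apply]
    · intro w _ hw
      simp [extendedMoment_apply, hw]
    · simp
  · intro z _ hz
    refine Finset.sum_eq_zero fun w _ => ?_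
    rw [contraction_apply_comm]
    by_cases hw : w = v
    · subst hw; simp [extendedMoment_apply, contraction_apply, hz]
    · simp [extendedMoment_apply, hw]
  · simp

lemma update_eq_iff_update_eq {u v : Config d M} {k : Fin M} {a : Fin d} :
    v = Function.update u k a ↔ v k = a ∧ v = Function.update u k (v k) := by
  constructor
  · intro h
    have : v k = a := by rw [h]; simp
    exact ⟨this, by rw [this]; exact h⟩
  · rintro ⟨rfl, h⟩
    exact h

/-- Both products vanish at entries whose output indices differ away from `k`; at the others,
equality is the `gl(d)` invariance of the moment for the indices `u k` and `v k`. That invariance is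
what requires the sum over all inputs. -/
lemma commute_extendedMoment (φ : Space d) (k : Fin M) :
    Commute (extendedMoment N M φ) (∑ i, contraction i k) := by
  rw [commute_iff_eq, Finset.mul_sum, Finset.sum_mul]
  ext ⟨x, u⟩ ⟨y, v⟩
  simp only [Matrix.sum_apply, extendedMoment_mul_contraction, contraction_mul_extendedMoment]
  by_cases h : v = Function.update u k (v k)
  · have h' : u = Function.update v k (u k) := by rw [h]; simp
    have h1 : ∀ i, v = Function.update u k (y i) ↔ y i = v k := fun i => by
      rw [update_eq_iff_update_eq, and_iff_left h, eq_comm]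
    have h2 : ∀ i, u = Function.update v k (x i) ↔ x i = u k := fun i => by
      rw [update_eq_iff_update_eq, and_iff_left h', eq_comm]
    simp only [h1, h2]
    exact sum_moment_update φ (u k) (v k) x y
  · have h' : ¬ u = Function.update v k (u k) := fun h' => h (by rw [h']; simp)
    have h1 : ∀ i, ¬ v = Function.update u k (y i) := fun i hi =>
      h (update_eq_iff_update_eq.mp hi).2
    have h2 : ∀ i, ¬ u = Function.update v k (x i) := fun i hi =>
      h' (update_eq_iff_update_eq.mp hi).2
    simp only [h1, h2, if_false]

lemma sum_moment_mul_choi {φ : Space d} (hφ : ‖φ‖ = 1) (T : Cloner d N M) :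
    ∑ x, ∑ y, moment N φ x y * ∑ u, T.choi (x, u) (y, u) = 1 := by
  simp only [T.sum_choi, mul_ite, mul_one, mul_zero, Finset.sum_ite_eq, Finset.mem_univ, if_true]
  exact trace_moment hφ

-- A product of commuting positive operators is positive; the second factor is the sum over the
-- inputs of the operators in `sum_contraction_le`.
open scoped Matrix.Norms.L2Operator MatrixOrder in
lemma extendedMoment_mul_posSemidef (hd : 1 ≤ d) (φ : Space d) :
    (extendedMoment N M φ * ((N * ((d : ℝ) + M - 1) : ℝ) • 1
      - ∑ k, ∑ i, contraction i k)).PosSemidef := by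
  rw [← Matrix.nonneg_iff_posSemidef]
  refine Commute.mul_nonneg ?_ ?_ ?_
  · exact ((moment_posSemidef φ).kronecker Matrix.PosSemidef.one).nonneg
  · have h : (N * ((d : ℝ) + M - 1) : ℝ) • (1 : Matrix (Config d N × Config d M) _ ℂ)
        - ∑ k, ∑ i, contraction i k =
        ∑ i : Fin N, (((d : ℝ) + M - 1 : ℝ) • 1 - ∑ k : Fin M, contraction i k) := by
      rw [Finset.sum_comm, Finset.sum_sub_distrib, Finset.sum_const, Finset.card_univ,
        Fintype.card_fin, ← Nat.cast_smul_eq_nsmul ℝ, smul_smul]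
    rw [h]
    exact (Matrix.posSemidef_sum _ fun i _ => sum_contraction_le hd i).nonneg
  · refine Commute.sub_right ((Commute.one_right _).smul_right _) ?_
    exact Commute.sum_right _ _ _ fun k _ => commute_extendedMoment φ k

/-- The contribution of the contractions to the average fidelity. -/
lemma re_sum_moment_update_mul_choi_le (hd : 1 ≤ d) {φ : Space d} (hφ : ‖φ‖ = 1)
    (T : Cloner d N M) :
    (∑ k, ∑ i, ∑ x, ∑ u, ∑ y, moment N φ x (Function.update y i (u k)) *
      T.choi (x, u) (y, Function.update u k (y i))).re ≤ N * ((d : ℝ) + M - 1) := by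
  have h := sum_mul_nonneg_of_posSemidef (extendedMoment_mul_posSemidef hd φ)
    T.choi_posSemidef
  have h1 : ∑ p, ∑ q, (extendedMoment N M φ *
      ∑ k : Fin M, ∑ i : Fin N, contraction (d := d) i k) p q * T.choi p q =
      ∑ k, ∑ i, ∑ x, ∑ u, ∑ y, moment N φ x (Function.update y i (u k)) *
      T.choi (x, u) (y, Function.update u k (y i)) := by
    simp only [Finset.mul_sum, Matrix.sum_apply, Finset.sum_mul]
    simp only [Finset.sum_comm (s := (Finset.univ : Finset (Config d N × Config d M)))
      (t := (Finset.univ : Finset (Fin M)))]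
    refine Finset.sum_congr rfl fun k _ => ?_
    simp only [Finset.sum_comm (s := (Finset.univ : Finset (Config d N × Config d M)))
      (t := (Finset.univ : Finset (Fin N)))]
    refine Finset.sum_congr rfl fun i _ => ?_
    simp only [Fintype.sum_prod_type, extendedMoment_mul_contraction, ite_mul, zero_mul,
      Finset.sum_ite_eq', Finset.mem_univ, if_true]
  have h2 : ∑ p, ∑ q, extendedMoment N M φ p q * T.choi p q = 1 := by
    rw [← sum_moment_mul_choi hφ T]
    simp only [Fintype.sum_prod_type, extendedMoment_apply, ite_mul, zero_mul, Finset.sum_ite_eq,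
      Finset.mem_univ, if_true, Finset.mul_sum]
    exact Finset.sum_congr rfl fun x _ => Finset.sum_comm
  simp only [mul_sub, Matrix.mul_smul, mul_one, Matrix.sub_apply, Matrix.smul_apply, sub_mul,
    smul_mul_assoc, Finset.sum_sub_distrib, ← Finset.smul_sum] at h
  rw [h1, h2] at h
  have h3 := (Complex.le_def.mp h).1
  rw [Complex.sub_re, Complex.smul_re, Complex.one_re, smul_eq_mul, mul_one, Complex.zero_re] at h3
  linarith

/-! ### Average fidelity and the cloning bound. -/

/-- The copy of `ψ` against which an output is tested joins the `N` input copies as slot `0`. -/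
lemma Cloner.totalFidelity_eq (T : Cloner d N M) (ψ : Space d) :
    T.totalFidelity ψ = (∑ k, ∑ x, ∑ u, ∑ y, ∑ b,
      pureTensorPower (N + 1) ψ (Fin.cons b x) (Fin.cons (u k) y) *
        T.choi (x, u) (y, Function.update u k b)).re := by
  rw [Cloner.totalFidelity, Complex.re_sum]
  refine Finset.sum_congr rfl fun k _ => ?_
  rw [fidelity]
  congr 1
  have h : inner ℂ ψ (Matrix.toEuclideanLin (reduced (T.map (pureTensorPower N ψ)) k) ψ) =
      ∑ a, ∑ u : Config d M with u k = a, ∑ b,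
        T.map (pureTensorPower N ψ) u (Function.update u k b) * ψ b * star (ψ (u k)) := by
    simp only [PiLp.inner_apply, RCLike.inner_apply, Matrix.ofLp_toLpLin, Matrix.toLin'_apply,
      Matrix.mulVec, dotProduct, reduced, Matrix.of_apply, Finset.sum_mul]
    refine Finset.sum_congr rfl fun a _ => ?_
    rw [Finset.sum_comm]
    refine Finset.sum_congr rfl fun u hu => Finset.sum_congr rfl fun b _ => ?_
    rw [(Finset.mem_filter.mp hu).2]
    rfl
  rw [h, Finset.sum_fiberwise]
  simp only [T.map_apply, Finset.sum_mul]
  rw [Finset.sum_comm (s := (Finset.univ : Finset (Config d N)))]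
  refine Finset.sum_congr rfl fun u _ => ?_
  rw [Finset.sum_comm]
  refine Finset.sum_congr rfl fun x _ => ?_
  rw [Finset.sum_comm]
  refine Finset.sum_congr rfl fun y _ => Finset.sum_congr rfl fun b _ => ?_
  simp only [pureTensorPower, Matrix.of_apply, Fin.prod_univ_succ, Fin.cons_zero, Fin.cons_succ]
  ring

lemma Cloner.integrable_totalFidelity (T : Cloner d N M) (φ : Space d) :
    Integrable (fun U => T.totalFidelity (rotate U φ)) (haarU d) := by
  simp only [T.totalFidelity_eq]
  refine integrable_of_continuous (Complex.continuous_re.comp ?_)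
  refine continuous_finsetSum _ fun k _ => continuous_finsetSum _ fun x _ =>
    continuous_finsetSum _ fun u _ => continuous_finsetSum _ fun y _ =>
    continuous_finsetSum _ fun b _ => ?_
  exact (continuous_pureTensorPower φ _ _).mul continuous_const

lemma Cloner.integral_totalFidelity (T : Cloner d N M) (φ : Space d) :
    ∫ U, T.totalFidelity (rotate U φ) ∂haarU d = (∑ k, ∑ x, ∑ u, ∑ y, ∑ b,
      moment (N + 1) φ (Fin.cons b x) (Fin.cons (u k) y) *
        T.choi (x, u) (y, Function.update u k b)).re := by
  have h0 : ∀ (x y : Config d N) (u : Config d M) (k : Fin M) (b : Fin d), Integrable (fun U =>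
      pureTensorPower (N + 1) (rotate U φ) (Fin.cons b x) (Fin.cons (u k) y) *
        T.choi (x, u) (y, Function.update u k b)) (haarU d) := fun x y u k b =>
    (integrable_pureTensorPower φ _ _).mul_const _
  have h1 := fun x y u k => integrable_finsetSum Finset.univ fun b _ => h0 x y u k b
  have h2 := fun x u k => integrable_finsetSum Finset.univ fun y _ => h1 x y u k
  have h3 := fun x k => integrable_finsetSum Finset.univ fun u _ => h2 x u k
  have h4 := fun k => integrable_finsetSum Finset.univ fun x _ => h3 x k
  have h5 := integrable_finsetSum Finset.univ fun k _ => h4 k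
  simp only [T.totalFidelity_eq]
  refine (integral_re h5).trans (congrArg Complex.re ?_)
  rw [integral_finsetSum _ fun k _ => h4 k]
  refine Finset.sum_congr rfl fun k _ => ?_
  rw [integral_finsetSum _ fun x _ => h3 x k]
  refine Finset.sum_congr rfl fun x _ => ?_
  rw [integral_finsetSum _ fun u _ => h2 x u k]
  refine Finset.sum_congr rfl fun u _ => ?_
  rw [integral_finsetSum _ fun y _ => h1 x y u k]
  refine Finset.sum_congr rfl fun y _ => ?_
  rw [integral_finsetSum _ fun b _ => h0 x y u k b]
  exact Finset.sum_congr rfl fun b _ => integral_mul_const _ _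

lemma Cloner.integral_totalFidelity_le (hd : 1 ≤ d) (T : Cloner d N M) {φ : Space d}
    (hφ : ‖φ‖ = 1) :
    ∫ U, T.totalFidelity (rotate U φ) ∂haarU d ≤ cloningBound d N M := by
  have hpos : (0 : ℝ) < (d : ℝ) + N := by positivity
  rw [cloningBound, le_div_iff₀ hpos, mul_comm, T.integral_totalFidelity]
  have h : ((d : ℂ) + N) * ∑ k, ∑ x, ∑ u, ∑ y, ∑ b,
      moment (N + 1) φ (Fin.cons b x) (Fin.cons (u k) y) *
        T.choi (x, u) (y, Function.update u k b) =
      M + ∑ k : Fin M, ∑ i : Fin N, ∑ x, ∑ u, ∑ y, moment N φ x (Function.update y i (u k)) *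
      T.choi (x, u) (y, Function.update u k (y i)) := by
    -- The diagonal term of the recursion sets `b = u k`; trace preservation makes it contribute `1`
    -- per output.
    have hM : (M : ℂ) = ∑ k : Fin M, ∑ x, ∑ u, ∑ y, moment N φ x y * T.choi (x, u) (y, u) := by
      have : ∑ x, ∑ u, ∑ y, moment N φ x y * T.choi (x, u) (y, u) = 1 := by
        rw [← sum_moment_mul_choi hφ T]
        simp only [Finset.mul_sum]
        exact Finset.sum_congr rfl fun x _ => Finset.sum_comm
      simp [this]
    rw [hM, ← Finset.sum_add_distrib, Finset.mul_sum]
    refine Finset.sum_congr rfl fun k _ => ?_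
    rw [Finset.sum_comm (s := (Finset.univ : Finset (Fin N))), ← Finset.sum_add_distrib,
      Finset.mul_sum]
    refine Finset.sum_congr rfl fun x _ => ?_
    rw [Finset.sum_comm (s := (Finset.univ : Finset (Fin N))), ← Finset.sum_add_distrib,
      Finset.mul_sum]
    refine Finset.sum_congr rfl fun u _ => ?_
    rw [Finset.sum_comm (s := (Finset.univ : Finset (Fin N))), ← Finset.sum_add_distrib,
      Finset.mul_sum]
    refine Finset.sum_congr rfl fun y _ => ?_
    simp only [Finset.mul_sum, ← mul_assoc, moment_cons_cons hφ, add_mul, Finset.sum_add_distrib,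
      ite_mul, zero_mul, Finset.sum_ite_eq, Finset.mem_univ, if_true, Function.update_eq_self,
      Finset.sum_mul]
    congr 1
    rw [Finset.sum_comm]
    simp
  have h' := congrArg Complex.re h
  have hc : ((d : ℂ) + N) = ((d + N : ℝ) : ℂ) := by push_cast; rfl
  rw [hc, Complex.re_ofReal_mul, Complex.add_re, Complex.natCast_re] at h'
  rw [h']
  have := re_sum_moment_update_mul_choi_le hd hφ T
  linarith

lemma Cloner.exists_totalFidelity_le (hd : 1 ≤ d) (T : Cloner d N M) :
    ∃ ψ : Space d, ‖ψ‖ = 1 ∧ T.totalFidelity ψ ≤ cloningBound d N M := by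
  have hφ : ‖(EuclideanSpace.single (⟨0, hd⟩ : Fin d) (1 : ℂ) : Space d)‖ = 1 := by simp
  obtain ⟨U, hU⟩ := exists_le_integral
    (T.integrable_totalFidelity (EuclideanSpace.single ⟨0, hd⟩ 1))
  exact ⟨_, (norm_rotate U _).trans hφ, hU.trans (T.integral_totalFidelity_le hd hφ)⟩

lemma cloningBound_sub_isBigO (N M : ℕ) : (fun d : ℕ => cloningBound d N M - (N : ℝ)) =O[atTop]
    (fun d : ℕ => 1 / (d : ℝ)) := by
  -- This is the numerator of `cloningBound d N M - N` over `d + N`, which is free of `d`.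
  refine IsBigO.of_bound |(N : ℝ) * M + M - N - N * N| ?_
  filter_upwards [eventually_ge_atTop 1] with d hd
  have hd' : (0 : ℝ) < d := by exact_mod_cast hd
  have h : cloningBound d N M - N = ((N : ℝ) * M + M - N - N * N) / (d + N) := by
    rw [cloningBound]
    field_simp
    ring
  rw [h, Real.norm_eq_abs, Real.norm_eq_abs, abs_div, abs_of_pos (by positivity : (0 : ℝ) < d + N),
    abs_of_pos (by positivity : (0 : ℝ) < 1 / d), mul_one_div]
  gcongr
  simp

end QuantumCloning

theorem mainTheorem5 (N M : ℕ) :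
    (∀ d : ℕ, 1 ≤ d → ∀ T : QuantumCloning.Cloner d N M,
      (∃ ψ : QuantumCloning.Space d, ‖ψ‖ = 1 ∧
        T.totalFidelity ψ ≤ QuantumCloning.cloningBound d N M) ∧
      (∀ φ : QuantumCloning.Space d, ‖φ‖ = 1 →
        Integrable (fun U : QuantumCloning.UGroup d => T.totalFidelity (QuantumCloning.rotate U φ))
          (QuantumCloning.haarU d) ∧
        ∫ U : QuantumCloning.UGroup d, T.totalFidelity (QuantumCloning.rotate U φ)
          ∂(QuantumCloning.haarU d) ≤ QuantumCloning.cloningBound d N M)) ∧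
    (fun d : ℕ => QuantumCloning.cloningBound d N M - (N : ℝ)) =O[atTop]
      (fun d : ℕ => 1 / (d : ℝ)) :=
  ⟨fun _ hd T => ⟨T.exists_totalFidelity_le hd, fun φ hφ =>
    ⟨T.integrable_totalFidelity φ, T.integral_totalFidelity_le hd hφ⟩⟩,
    QuantumCloning.cloningBound_sub_isBigO N M⟩
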